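/- Let $\mathbb{X}$ be a metric space with its Borel $\sigma$-algebra, let $\varpi$ be a finite Borel measure on $\mathbb{X}$ that is positive in the sense that $\varpi(U)>0$ for every non-empty open set $U\subseteq\mathbb{X}$, let $\mu=\varpi\times\varpi$ be the product measure on $\mathbb{X}^2$, and let $\mathcal{E}$ be one of the sets $\mathbb{R}$, $\mathbb{R}_{\geq 0}$, $\mathbb{R}_{\leq 0}$. A function $\rho:\mathbb{X}\times\mathbb{X}\to\mathbb{R}$ is called the non-centered covariance of a random field on $\mathbb{X}$ with values in $\mathcal{E}$ if there is a family $(Z(x))_{x\in\mathbb{X}}$ of $\mathcal{E}$-valued, square integrable random variables on a common probability space such that $\rho(x,y)=\mathbb{E}(Z(x)Z(y))$ for all $x,y\in\mathbb{X}$. For $\lambda\in L^2(\mathbb{X}^2,\mu)$ the $\gamma$-gap of $\lambda$ on $\mathcal{E}$ is $$\gamma(\lambda,\mathcal{E},\mu)=\inf\left\{\int_{\mathbb{X}^2}\lambda(x,y)\,z(x)\,z(y)\,\mathrm{d}\mu(x,y)\;:\; z:\mathbb{X}\to\mathcal{E},\ \big((x,y)\mapsto z(x)z(y)\big)\in L^2(\mathbb{X}^2,\mu)\right\}\in[-\infty,+\infty].$$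 Then a continuous function $\rho:\mathbb{X}\times\mathbb{X}\to\mathbb{R}$ is the non-centered covariance of a random field on $\mathbb{X}$ with values in $\mathcal{E}$ if, and only if, it fulfills the following two conditions: 1. Symmetry: $\rho(x,y)=\rho(y,x)$ for all $x,y\in\mathbb{X}$. 2. Gap inequalities: for every symmetric continuous function $\lambda:\mathbb{X}\times\mathbb{X}\to\mathbb{R}$ in $L^2(\mathbb{X}^2,\mu)$ for which the integral below exists in $[-\infty,+\infty]$ (that is, the positive part or the negative part of $\lambda\rho$ is $\mu$-integrable), one has $$\int_{\mathbb{X}^2}\lambda(x,y)\,\rho(x,y)\,\mathrm{d}\mu(x,y)\;\geq\;\gamma(\lambda,\mathcal{E},\mu).$$ -/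

import Mathlib

open MeasureTheory

noncomputable section

/-- `ρ` is the non-centered covariance of a random field on `X` with values in `E`. The random field
is the coordinate process `Z(x, ω) = ω x` on the sample space `E ^ X` (with the product `σ`-algebra,
so that each `Z(x, ·)` is a random variable) under some probability measure `P`; every `Z(x, ·)` is
square integrable, and `ρ (x, y)` is the expectation of `Z(x, ·) Z(y, ·)`.
Any family of `E`-valued random variables indexed by `X` on one probability space induces such
a `P`, namely its joint law. -/
def IsNonCenteredCovariance {X : Type*} (E : Set ℝ) (ρ : X × X → ℝ) : Prop :=
  ∃ P : Measure (X → E), IsProbabilityMeasure P ∧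
    (∀ x : X, MemLp (fun ω : X → E => (ω x : ℝ)) 2 P) ∧
    ∀ x y : X, ρ (x, y) = ∫ ω : X → E, (ω x : ℝ) * (ω y : ℝ) ∂P

/-- The `γ`-gap of `lam` on `E` with respect to a measure `μ` on `X × X`: the infimum, in the
extended reals, of `∫ lam(x,y) z(x) z(y) dμ(x,y)` over all functions `z : X → ℝ` with values in `E`
such that `(x, y) ↦ z(x) z(y)` is in `L²(μ)`. It is meant for `lam` in `L²(μ)`; all the integrals
are then convergent. -/
def gammaGap {X : Type*} [MeasurableSpace X] (lam : X × X → ℝ) (E : Set ℝ)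
    (μ : Measure (X × X)) : EReal :=
  ⨅ z ∈ {z : X → ℝ | (∀ x, z x ∈ E) ∧ MemLp (fun p : X × X => z p.1 * z p.2) 2 μ},
    ((∫ p : X × X, lam p * (z p.1 * z p.2) ∂μ : ℝ) : EReal)

/-- The integral of the real function `f` exists in the extended sense: at least one of the
integrals of its positive and negative parts is finite. -/
def ExtIntegralExists {Y : Type*} [MeasurableSpace Y] (f : Y → ℝ) (μ : Measure Y) : Prop :=
  (∫⁻ y, ENNReal.ofReal (f y) ∂μ) ≠ ⊤ ∨ (∫⁻ y, ENNReal.ofReal (-f y) ∂μ) ≠ ⊤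

/-- The extended-real-valued integral of `f`: the integral of the positive part minus the integral
of the negative part (meaningful when `ExtIntegralExists f μ`). -/
def extIntegral {Y : Type*} [MeasurableSpace Y] (f : Y → ℝ) (μ : Measure Y) : EReal :=
  ((∫⁻ y, ENNReal.ofReal (f y) ∂μ : ENNReal) : EReal) -
    ((∫⁻ y, ENNReal.ofReal (-f y) ∂μ : ENNReal) : EReal)

end

open Filter Topology

/-! Sufficiency. Testing the gap inequality on `λ` concentrated near finitely many points puts `ρ`,
restricted to any family of points, in the dual of the cone of quadratic forms nonnegative on
`E`-valued vectors (`satisfiesFiniteGapInequalities_of_gammaGap_le`). On a dense sequence this is a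
moment problem. The `E`-valued sequences are not compact, but quadratic forms are homogeneous and
`E` is a cone, so a weighted `ℓ²` ball, compact by Tychonoff, can serve as sample space; Hahn-Banach
then yields the law (`exists_probabilityMeasure_integral_eq`). Continuity of `ρ` extends the
sequence, as a map into `L²`, to all of `X` (`IsNonCenteredCovariance.of_denseRange`).

Necessity. Sample paths need not be measurable, but a path composed with a simple function and cut
off outside a set is a competitor in the gap. Averaging over paths gives the inequality for a
discretized `ρ`; dominated convergence removes the discretization where `ρ(x,x)` is bounded
(`gammaGap_le_setIntegral`), and exhaustion removes the bound. -/

/-! ### Separability of the index space -/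

/-- A metric space carrying an s-finite measure that charges every nonempty open set is second
countable. -/
theorem secondCountableTopology_of_isOpenPosMeasure {X : Type*} [MetricSpace X] [MeasurableSpace X]
    [BorelSpace X] (ϖ : Measure X) [SFinite ϖ] [ϖ.IsOpenPosMeasure] :
    SecondCountableTopology X := by
  refine Metric.secondCountable_of_almost_dense_set fun ε hε => ?_
  -- A maximal `ε`-separated set: disjoint balls of positive measure make it countable, maximality
  -- makes it `ε`-dense.
  obtain ⟨S, hS⟩ := zorn_subset {S : Set X | S.Pairwise fun x y => ε < dist x y} (by
    intro c hc hchain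
    refine ⟨⋃₀ c, ?_, fun s hs => Set.subset_sUnion_of_mem hs⟩
    exact (Set.pairwise_sUnion hchain.directedOn).2 fun s hs => hc hs)
  refine ⟨S, ?_, fun x => ?_⟩
  · have hdisj : Pairwise (Function.onFun Disjoint fun s : S => Metric.ball (s : X) (ε / 2)) := by
      intro s t hst
      refine Metric.ball_disjoint_ball ?_
      have := hS.prop s.2 t.2 (fun h => hst (Subtype.ext h))
      linarith
    have hcount := Measure.countable_meas_pos_of_disjoint_iUnion (μ := ϖ)
      (fun _ => Metric.isOpen_ball.measurableSet) hdisj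
    have huniv : {s : S | 0 < ϖ (Metric.ball (s : X) (ε / 2))} = Set.univ :=
      Set.eq_univ_of_forall fun s => Metric.measure_ball_pos ϖ _ (half_pos hε)
    rw [huniv, Set.countable_univ_iff] at hcount
    exact Set.countable_coe_iff.1 hcount
  · by_contra! hx
    have hmem : insert x S ∈ {S : Set X | S.Pairwise fun x y => ε < dist x y} :=
      hS.prop.insert fun y hy _ => ⟨hx y hy, by rw [dist_comm]; exact hx y hy⟩
    have hxS : x ∈ S := hS.le_of_ge hmem (Set.subset_insert _ _) (Set.mem_insert _ _)
    have := hx x hxS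
    simp at this
    linarith

/-! ### Duality for moments on a compact space -/

/-- A continuous linear functional on a power of `ℝ` depends on finitely many coordinates. -/
theorem exists_finset_eq_sum_of_continuousLinearMap {ι : Type*} [DecidableEq ι]
    (f : (ι → ℝ) →L[ℝ] ℝ) :
    ∃ F : Finset ι, ∀ v, f v = ∑ i ∈ F, f (Pi.single i 1) * v i := by
  have hnhds : f ⁻¹' Metric.ball 0 1 ∈ 𝓝 (0 : ι → ℝ) :=
    f.continuous.continuousAt.preimage_mem_nhds (by simpa using Metric.ball_mem_nhds _ one_pos)
  rw [nhds_pi, Filter.mem_pi] at hnhds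
  obtain ⟨I, hI, t, ht, hsub⟩ := hnhds
  have hzero : ∀ v : ι → ℝ, (∀ i ∈ I, v i = 0) → f v = 0 := by
    intro v hv
    by_contra hne
    -- Vanishing on `I` survives scaling, so the rescaled vector stays in the neighbourhood although
    -- `f` equals 1 there.
    have hmem : (f v)⁻¹ • v ∈ f ⁻¹' Metric.ball 0 1 := by
      refine hsub fun i hi => ?_
      simp only [Pi.smul_apply, hv i hi, smul_zero]
      exact mem_of_mem_nhds (ht i)
    simp [hne] at hmem
  refine ⟨hI.toFinset, fun v => ?_⟩
  have hv := hzero (v - ∑ i ∈ hI.toFinset, v i • Pi.single i (1 : ℝ)) fun j hj => by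
    have : ∀ i, v i * (Pi.single i (1 : ℝ) : ι → ℝ) j = if i = j then v j else 0 := by
      intro i
      rcases eq_or_ne i j with rfl | h
      · simp
      · simp [h]
    simp [Finset.sum_apply, this, hj]
  rw [map_sub, map_sum, sub_eq_zero] at hv
  simpa [mul_comm] using hv

theorem integral_convexComb {Ω : Type*} [MeasurableSpace Ω] {P Q : Measure Ω} {a b : ℝ}
    (ha : 0 ≤ a) (hb : 0 ≤ b) {g : Ω → ℝ} (hP : Integrable g P) (hQ : Integrable g Q) :
    ∫ ω, g ω ∂(ENNReal.ofReal a • P + ENNReal.ofReal b • Q)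
      = a * ∫ ω, g ω ∂P + b * ∫ ω, g ω ∂Q := by
  rw [integral_add_measure (hP.smul_measure ENNReal.ofReal_ne_top)
    (hQ.smul_measure ENNReal.ofReal_ne_top), integral_smul_measure, integral_smul_measure]
  simp [ha, hb]

theorem isProbabilityMeasure_convexComb {Ω : Type*} [MeasurableSpace Ω] {P Q : Measure Ω}
    [IsProbabilityMeasure P] [IsProbabilityMeasure Q] {a b : ℝ}
    (ha : 0 ≤ a) (hb : 0 ≤ b) (hab : a + b = 1) :
    IsProbabilityMeasure (ENNReal.ofReal a • P + ENNReal.ofReal b • Q) := by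
  constructor
  simp [← ENNReal.ofReal_add ha hb, hab]

/-- On a compact space, a function `r` is the vector of integrals of a family `g` of continuous
functions against some probability measure, if every linear inequality satisfied by the values of
finitely many members of the family is satisfied by `r`. -/
theorem exists_probabilityMeasure_integral_eq {ι Ω : Type*} [TopologicalSpace Ω] [CompactSpace Ω]
    [T2Space Ω] [MeasurableSpace Ω] [BorelSpace Ω] (g : ι → C(Ω, ℝ)) (r : ι → ℝ)
    (h : ∀ (F : Finset ι) (c : ι → ℝ) (s : ℝ),
      (∀ ω, s ≤ ∑ i ∈ F, c i * g i ω) → s ≤ ∑ i ∈ F, c i * r i) :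
    ∃ P : Measure Ω, IsProbabilityMeasure P ∧ ∀ i, ∫ ω, g i ω ∂P = r i := by
  classical
  let m : ProbabilityMeasure Ω → ι → ℝ := fun P i => ∫ ω, g i ω ∂(P : Measure Ω)
  have hint : ∀ i (P : ProbabilityMeasure Ω), Integrable (g i) (P : Measure Ω) := fun i P =>
    (BoundedContinuousFunction.mkOfCompact (g i)).integrable _
  have hm : Continuous m := continuous_pi fun i =>
    ProbabilityMeasure.continuous_integral_boundedContinuousFunction
      (BoundedContinuousFunction.mkOfCompact (g i))
  -- Weak compactness of the probability measures on a compact space gives closedness.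
  have hclosed : IsClosed (Set.range m) := (isCompact_range hm).isClosed
  have hconv : Convex ℝ (Set.range m) := by
    rintro _ ⟨P, rfl⟩ _ ⟨Q, rfl⟩ a b ha hb hab
    refine ⟨⟨_, isProbabilityMeasure_convexComb (P := (P : Measure Ω)) (Q := (Q : Measure Ω))
      ha hb hab⟩, ?_⟩
    ext i
    exact integral_convexComb ha hb (hint i P) (hint i Q)
  suffices hr : r ∈ Set.range m by
    obtain ⟨P, hP⟩ := hr
    exact ⟨P, inferInstance, fun i => congrFun hP i⟩
  by_contra hr
  obtain ⟨f, u, hfr, hfu⟩ := geometric_hahn_banach_point_closed hconv hclosed hr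
  obtain ⟨F, hF⟩ := exists_finset_eq_sum_of_continuousLinearMap f
  refine absurd (h F (fun i => f (Pi.single i 1)) u fun ω => ?_) (by rw [← hF]; exact hfr.not_ge)
  -- Dirac masses turn the separating functional into a pointwise inequality.
  have hω := hfu _ ⟨⟨Measure.dirac ω, inferInstance⟩, rfl⟩
  rw [hF] at hω
  simpa [m] using hω.le

/-! ### Random sequences from finite gap inequalities -/

/-- The kernel `r` lies in the dual of the cone of quadratic forms in finitely many variables that
are nonnegative for variables in `E`. -/
def SatisfiesFiniteGapInequalities {ι : Type*} (E : Set ℝ) (r : ι × ι → ℝ) : Prop :=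
  ∀ (F : Finset (ι × ι)) (c : ι × ι → ℝ),
    (∀ z : ι → ℝ, (∀ i, z i ∈ E) → 0 ≤ ∑ p ∈ F, c p * (z p.1 * z p.2)) → 0 ≤ ∑ p ∈ F, c p * r p

namespace SatisfiesFiniteGapInequalities

variable {ι : Type*} {E : Set ℝ} {r : ι × ι → ℝ}

/-- Allows a weighted square norm to be added to a form whose index set `F` may already contain
diagonal pairs: overlapping coefficients are merged. -/
theorem add_diagonal (h : SatisfiesFiniteGapInequalities E r) (F : Finset (ι × ι)) (c : ι × ι → ℝ)
    (S : Finset ι) (b : ι → ℝ)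
    (hz : ∀ z : ι → ℝ, (∀ i, z i ∈ E) →
      0 ≤ ∑ p ∈ F, c p * (z p.1 * z p.2) + ∑ i ∈ S, b i * (z i * z i)) :
    0 ≤ ∑ p ∈ F, c p * r p + ∑ i ∈ S, b i * r (i, i) := by
  classical
  have key : ∀ x : ι × ι → ℝ, ∑ p ∈ F ∪ S.diag,
      ((if p ∈ F then c p else 0) + if p ∈ S.diag then b p.1 else 0) * x p
        = ∑ p ∈ F, c p * x p + ∑ i ∈ S, b i * x (i, i) := by
    intro x
    simp only [add_mul, Finset.sum_add_distrib, ite_mul, zero_mul, Finset.sum_ite_mem]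
    rw [Finset.inter_eq_right.2 Finset.subset_union_left,
      Finset.inter_eq_right.2 Finset.subset_union_right, Finset.sum_diag]
  rw [← key]
  refine h _ _ fun z hzE => ?_
  rw [key fun p => z p.1 * z p.2]
  exact hz z hzE

theorem diagonal_nonneg (h : SatisfiesFiniteGapInequalities E r) (i : ι) : 0 ≤ r (i, i) := by
  simpa using h {(i, i)} 1 fun z _ => by simpa using mul_self_nonneg (z i)

end SatisfiesFiniteGapInequalities

/-- The `E`-valued families in the unit ball of the weighted `ℓ²` norm with weights `a`. -/
def weightedBall {ι : Type*} (E : Set ℝ) (a : ι → ℝ) : Set (ι → ℝ) :=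
  {z | (∀ i, z i ∈ E) ∧ ∀ T : Finset ι, ∑ i ∈ T, a i * (z i * z i) ≤ 1}

/-- Singletons `T` bound each coordinate, and the finite partial sums give conditions closed in the
product topology, so Tychonoff applies. -/
theorem isCompact_weightedBall {ι : Type*} {E : Set ℝ} (hE : IsClosed E) {a : ι → ℝ}
    (ha : ∀ i, 0 < a i) : IsCompact (weightedBall E a) := by
  refine (isCompact_univ_pi fun i =>
    isCompact_Icc (a := -√(1 / a i)) (b := √(1 / a i))).of_isClosed_subset ?_ fun z hz i _ => ?_
  · simp only [weightedBall, Set.ofPred_and, Set.ofPred_forall]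
    refine (isClosed_iInter fun i => hE.preimage (continuous_apply i)).inter
      (isClosed_iInter fun T => isClosed_le (by fun_prop) continuous_const)
  · have h1 := hz.2 {i}
    rw [Finset.sum_singleton] at h1
    refine Set.mem_Icc.2 (abs_le.1 (Real.abs_le_sqrt ?_))
    rw [le_div_iff₀ (ha i)]
    linarith

/-- A kernel on a countable set that satisfies the finite gap inequalities is the family of second
moments of a sequence of random variables with values in the closed cone `E`. -/
theorem SatisfiesFiniteGapInequalities.exists_randomVariables {ι : Type} [Countable ι] {E : Set ℝ}
    (hE : IsClosed E) (h0 : (0 : ℝ) ∈ E) (hcone : ∀ t z : ℝ, 0 ≤ t → z ∈ E → t * z ∈ E)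
    {r : ι × ι → ℝ} (h : SatisfiesFiniteGapInequalities E r) :
    ∃ (Ω : Type) (_ : MeasurableSpace Ω) (P : Measure Ω) (Z : ι → Ω → ℝ), IsProbabilityMeasure P ∧
      (∀ i, MemLp (Z i) 2 P) ∧ (∀ i ω, Z i ω ∈ E) ∧
        ∀ i j, ∫ ω, Z i ω * Z j ω ∂P = r (i, j) := by
  classical
  -- Summable weights with total at most 1, divided by `1 + r (i, i)`; the 1 avoids a zero
  -- denominator.
  obtain ⟨a, ha, har⟩ : ∃ a : ι → ℝ, (∀ i, 0 < a i) ∧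
      ∀ T : Finset ι, ∑ i ∈ T, a i * r (i, i) ≤ 1 := by
    have := Encodable.ofCountable ι
    obtain ⟨w, hw, s, hs, hs1⟩ := posSumOfEncodable (ε := 1) one_pos ι
    have hr : ∀ i, 0 < 1 + r (i, i) := fun i => by linarith [h.diagonal_nonneg i]
    refine ⟨fun i => w i / (1 + r (i, i)), fun i => div_pos (hw i) (hr i), fun T => ?_⟩
    refine le_trans (Finset.sum_le_sum fun i _ => ?_)
      ((sum_le_hasSum T (fun i _ => (hw i).le) hs).trans hs1)
    rw [div_mul_eq_mul_div, div_le_iff₀ (hr i)]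
    exact mul_le_mul_of_nonneg_left (by linarith) (hw i).le
  have hK := isCompact_weightedBall hE ha
  have : CompactSpace (weightedBall E a) := isCompact_iff_compactSpace.1 hK
  have hzero : (0 : ι → ℝ) ∈ weightedBall E a := ⟨fun _ => h0, fun T => by simp⟩
  let g : ι × ι → C(weightedBall E a, ℝ) := fun p =>
    ⟨fun k => k.1 p.1 * k.1 p.2,
      ((continuous_apply p.1).comp continuous_subtype_val).mul
        ((continuous_apply p.2).comp continuous_subtype_val)⟩
  obtain ⟨P, hP, hPr⟩ := exists_probabilityMeasure_integral_eq g r fun F c s hs => by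
    have hs0 : s ≤ 0 := by simpa [g] using hs ⟨0, hzero⟩
    let S : Finset ι := F.image Prod.fst ∪ F.image Prod.snd
    have hS1 : ∀ p ∈ F, p.1 ∈ S := fun p hp =>
      Finset.mem_union_left _ (Finset.mem_image_of_mem _ hp)
    have hS2 : ∀ p ∈ F, p.2 ∈ S := fun p hp =>
      Finset.mem_union_right _ (Finset.mem_image_of_mem _ hp)
    -- By homogeneity, a lower bound `s` on the ball says that the form minus `s` times the weighted
    -- square norm is nonnegative; `s ≤ 0` settles the part of the norm outside `S`.
    have hdiag := h.add_diagonal F c S (fun i => -s * a i) fun z hz => by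
      have hnn : ∀ i, 0 ≤ a i * (z i * z i) := fun i =>
        mul_nonneg (ha i).le (mul_self_nonneg _)
      have hfac : ∑ i ∈ S, -s * a i * (z i * z i) = -s * ∑ i ∈ S, a i * (z i * z i) := by
        rw [Finset.mul_sum]
        exact Finset.sum_congr rfl fun i _ => by ring
      rw [hfac]
      rcases (Finset.sum_nonneg fun i (_ : i ∈ S) => hnn i).eq_or_lt with hq | hq
      · have hz0 : ∀ i ∈ S, z i = 0 := fun i hi => by
          have := (Finset.sum_eq_zero_iff_of_nonneg fun i _ => hnn i).1 hq.symm i hi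
          simpa [(ha i).ne'] using this
        rw [← hq, Finset.sum_eq_zero fun p hp => by rw [hz0 _ (hS1 p hp)]; ring]
        simp
      · set q := ∑ i ∈ S, a i * (z i * z i) with hq_def
        have hsq : (√q)⁻¹ * (√q)⁻¹ = q⁻¹ := by rw [← mul_inv, Real.mul_self_sqrt hq.le]
        -- Normalized, and zero off `S` so that the norm bound holds for every finite `T`.
        let k : ι → ℝ := fun i => if i ∈ S then (√q)⁻¹ * z i else 0
        have hk : k ∈ weightedBall E a := by
          refine ⟨fun i => ?_, fun T => ?_⟩
          · by_cases hi : i ∈ S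
            · simpa [k, hi] using hcone _ _ (by positivity) (hz i)
            · simpa [k, hi] using h0
          · calc ∑ i ∈ T, a i * (k i * k i)
                = ∑ i ∈ T, if i ∈ S then q⁻¹ * (a i * (z i * z i)) else 0 := by
                  refine Finset.sum_congr rfl fun i _ => ?_
                  by_cases hi : i ∈ S
                  · simp only [k, hi, if_true, ← hsq]; ring
                  · simp [k, hi]
              _ = q⁻¹ * ∑ i ∈ T ∩ S, a i * (z i * z i) := by
                  rw [Finset.sum_ite_mem, Finset.mul_sum]
              _ ≤ q⁻¹ * q := by
                  refine mul_le_mul_of_nonneg_left ?_ (by positivity)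
                  exact Finset.sum_le_sum_of_subset_of_nonneg Finset.inter_subset_right
                    fun i _ _ => hnn i
              _ = 1 := inv_mul_cancel₀ hq.ne'
        have hsk := hs ⟨k, hk⟩
        have heq : ∑ p ∈ F, c p * g p ⟨k, hk⟩ = q⁻¹ * ∑ p ∈ F, c p * (z p.1 * z p.2) := by
          rw [Finset.mul_sum]
          refine Finset.sum_congr rfl fun p hp => ?_
          simp only [g, k, ContinuousMap.coe_mk, hS1 p hp, hS2 p hp, if_true, ← hsq]
          ring
        rw [heq, ← div_eq_inv_mul, le_div_iff₀ hq] at hsk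
        linarith
    have hfac : ∑ i ∈ S, -s * a i * r (i, i) = -s * ∑ i ∈ S, a i * r (i, i) := by
      rw [Finset.mul_sum]
      exact Finset.sum_congr rfl fun i _ => by ring
    rw [hfac] at hdiag
    have := mul_le_mul_of_nonneg_left (har S) (neg_nonneg.2 hs0)
    linarith
  refine ⟨weightedBall E a, inferInstance, P, fun i k => k.1 i, hP, fun i => ?_,
    fun i k => k.2.1 i, fun i j => hPr (i, j)⟩
  have hcont : Continuous fun k : weightedBall E a => k.1 i :=
    (continuous_apply i).comp continuous_subtype_val
  obtain ⟨C, hC⟩ := isCompact_univ.exists_bound_of_continuousOn hcont.continuousOn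
  exact MemLp.of_bound hcont.aestronglyMeasurable C
    (Filter.Eventually.of_forall fun k => hC k (Set.mem_univ k))

/-! ### From a dense sequence to the whole space -/

/-- A random field built on some probability space as a family of `L²` classes induces one on the
canonical space. -/
theorem IsNonCenteredCovariance.of_Lp {X Ω : Type*} [MeasurableSpace Ω] {P : Measure Ω}
    [IsProbabilityMeasure P] {E : Set ℝ} (hE : IsClosed E) (h0 : (0 : ℝ) ∈ E) {ρ : X × X → ℝ}
    (W : X → Lp ℝ 2 P) (hW : ∀ x, ∀ᵐ ω ∂P, W x ω ∈ E)
    (hρ : ∀ x y, inner ℝ (W x) (W y) = ρ (x, y)) : IsNonCenteredCovariance E ρ := by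
  classical
  let V : X → Ω → ℝ := fun x ω => if W x ω ∈ E then W x ω else 0
  have hVE : ∀ x ω, V x ω ∈ E := fun x ω => by
    by_cases h : W x ω ∈ E
    · simp [V, h]
    · simpa [V, h] using h0
  have hVm : ∀ x, Measurable (V x) := fun x =>
    Measurable.ite ((Lp.stronglyMeasurable (W x)).measurable hE.measurableSet)
      (Lp.stronglyMeasurable (W x)).measurable measurable_const
  have hVW : ∀ x, V x =ᵐ[P] W x := fun x => by
    filter_upwards [hW x] with ω hω
    simp [V, hω]
  let T : Ω → X → E := fun ω x => ⟨V x ω, hVE x ω⟩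
  have hT : Measurable T := measurable_pi_iff.2 fun x => (hVm x).subtype_mk
  have heval : ∀ x, Measurable fun ω : X → E => (ω x : ℝ) := fun x =>
    measurable_subtype_coe.comp (measurable_pi_apply x)
  refine ⟨P.map T, Measure.isProbabilityMeasure_map hT.aemeasurable, fun x => ?_, fun x y => ?_⟩
  · rw [memLp_map_measure_iff (heval x).aestronglyMeasurable hT.aemeasurable]
    exact (memLp_congr_ae (hVW x)).2 (Lp.memLp (W x))
  · have hmeas : Measurable fun ω : X → E => (ω x : ℝ) * ω y := (heval x).mul (heval y)
    rw [integral_map hT.aemeasurable hmeas.aestronglyMeasurable, ← hρ, L2.inner_def]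
    refine integral_congr_ae ?_
    filter_upwards [hVW x, hVW y] with ω hx hy
    simp [T, hx, hy, mul_comm]

theorem ae_mem_of_tendsto_Lp {Ω : Type*} [MeasurableSpace Ω] {P : Measure Ω} {E : Set ℝ}
    (hE : IsClosed E) {f : ℕ → Lp ℝ 2 P} {g : Lp ℝ 2 P} (hfg : Tendsto f atTop (𝓝 g))
    (hf : ∀ n, ∀ᵐ ω ∂P, f n ω ∈ E) : ∀ᵐ ω ∂P, g ω ∈ E := by
  obtain ⟨ns, -, hns⟩ := (tendstoInMeasure_of_tendsto_Lp hfg).exists_seq_tendsto_ae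
  filter_upwards [hns, ae_all_iff.2 hf] with ω hω hmem
  exact hE.mem_of_tendsto hω (Eventually.of_forall fun n => hmem (ns n))

/-- If a continuous kernel is the covariance of a random field along a dense sequence, then it is
the covariance of a random field on the whole space. -/
theorem IsNonCenteredCovariance.of_denseRange {X Ω : Type*} [PseudoMetricSpace X]
    [MeasurableSpace Ω]
    {P : Measure Ω} [IsProbabilityMeasure P] {E : Set ℝ} (hE : IsClosed E) (h0 : (0 : ℝ) ∈ E)
    {ρ : X × X → ℝ} (hρ : Continuous ρ) {d : ℕ → X} (hd : DenseRange d) {Z : ℕ → Ω → ℝ}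
    (hZ : ∀ i, MemLp (Z i) 2 P) (hZE : ∀ i ω, Z i ω ∈ E)
    (hZρ : ∀ i j, ∫ ω, Z i ω * Z j ω ∂P = ρ (d i, d j)) : IsNonCenteredCovariance E ρ := by
  let z : ℕ → Lp ℝ 2 P := fun i => (hZ i).toLp
  have hinner : ∀ i j, inner ℝ (z i) (z j) = ρ (d i, d j) := fun i j => by
    rw [← hZρ, L2.inner_def]
    refine integral_congr_ae ?_
    filter_upwards [(hZ i).coeFn_toLp, (hZ j).coeFn_toLp] with ω hi hj
    simp [z, hi, hj, mul_comm]
  have hseq : ∀ x, ∃ u : ℕ → ℕ, Tendsto (fun n => d (u n)) atTop (𝓝 x) := fun x => by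
    obtain ⟨v, hv, hlim⟩ := mem_closure_iff_seq_limit.1 (hd x)
    choose u hu using hv
    exact ⟨u, by simpa only [hu] using hlim⟩
  choose u hu using hseq
  -- The squared distance expands into three values of `ρ` near `(x, x)`, with limit `ρ (x, x) - 2 ρ
  -- (x, x) + ρ (x, x) = 0`.
  have hcauchy : ∀ x, CauchySeq fun n => z (u x n) := fun x => by
    rw [cauchySeq_iff_tendsto_dist_atTop_0, ← prod_atTop_atTop_eq]
    have h1 : Tendsto (fun p : ℕ × ℕ => d (u x p.1)) (atTop ×ˢ atTop) (𝓝 x) :=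
      (hu x).comp tendsto_fst
    have h2 : Tendsto (fun p : ℕ × ℕ => d (u x p.2)) (atTop ×ˢ atTop) (𝓝 x) :=
      (hu x).comp tendsto_snd
    have hlim := (((hρ.tendsto (x, x)).comp (h1.prodMk_nhds h1)).sub
      (((hρ.tendsto (x, x)).comp (h1.prodMk_nhds h2)).const_mul 2)).add
        ((hρ.tendsto (x, x)).comp (h2.prodMk_nhds h2))
    have hsqrt := hlim.sqrt
    rw [show ρ (x, x) - 2 * ρ (x, x) + ρ (x, x) = 0 by ring, Real.sqrt_zero] at hsqrt
    refine hsqrt.congr fun p => ?_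
    rw [dist_eq_norm, ← Real.sqrt_sq (norm_nonneg (z (u x p.1) - z (u x p.2))),
      norm_sub_sq_real, ← real_inner_self_eq_norm_sq, ← real_inner_self_eq_norm_sq,
      hinner, hinner, hinner]
    rfl
  choose W hW using fun x => cauchySeq_tendsto_of_complete (hcauchy x)
  refine IsNonCenteredCovariance.of_Lp hE h0 W (fun x => ?_) fun x y => ?_
  · refine ae_mem_of_tendsto_Lp hE (hW x) fun n => ?_
    filter_upwards [(hZ (u x n)).coeFn_toLp] with ω hω
    rw [hω]
    exact hZE _ _
  · refine tendsto_nhds_unique ((hW x).inner (hW y)) ?_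
    simp only [hinner]
    exact (hρ.tendsto (x, y)).comp ((hu x).prodMk_nhds (hu y))

/-! ### Gap inequalities imply finite gap inequalities -/

theorem extIntegral_eq_integral {Y : Type*} [MeasurableSpace Y] {f : Y → ℝ} {μ : Measure Y}
    (hf : Integrable f μ) : extIntegral f μ = ((∫ y, f y ∂μ : ℝ) : EReal) := by
  have hneg : ∫⁻ y, ENNReal.ofReal (-f y) ∂μ ≠ ⊤ := hf.neg.lintegral_lt_top.ne
  rw [integral_eq_lintegral_pos_part_sub_lintegral_neg_part hf, EReal.coe_sub,
    EReal.coe_ennreal_toReal hf.lintegral_lt_top.ne, EReal.coe_ennreal_toReal hneg]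
  rfl

theorem extIntegralExists_of_integrable {Y : Type*} [MeasurableSpace Y] {f : Y → ℝ} {μ : Measure Y}
    (hf : Integrable f μ) : ExtIntegralExists f μ :=
  Or.inl hf.lintegral_lt_top.ne

/-- Continuous probability densities with support in a given ball. -/
theorem exists_continuous_density {X : Type*} [MetricSpace X] [MeasurableSpace X] [BorelSpace X]
    (ϖ : Measure X) [IsFiniteMeasure ϖ] [ϖ.IsOpenPosMeasure] (x₀ : X) {δ : ℝ} (hδ : 0 < δ) :
    ∃ ψ : X → ℝ, Continuous ψ ∧ (∀ x, 0 ≤ ψ x) ∧ (∃ C, ∀ x, ψ x ≤ C) ∧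
      (∀ x, ψ x ≠ 0 → dist x x₀ < δ) ∧ ∫ x, ψ x ∂ϖ = 1 := by
  let φ : X → ℝ := fun x => max 0 (1 - dist x x₀ / δ)
  have hφ : Continuous φ := by fun_prop
  have hφ0 : ∀ x, 0 ≤ φ x := fun x => le_max_left _ _
  have hφ1 : ∀ x, φ x ≤ 1 := fun x =>
    max_le zero_le_one (by have : 0 ≤ dist x x₀ / δ := by positivity
                           linarith)
  have hint : Integrable φ ϖ :=
    Integrable.of_bound (C := 1) hφ.aestronglyMeasurable (Eventually.of_forall fun x => by
      rw [Real.norm_of_nonneg (hφ0 x)]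
      exact hφ1 x)
  have hpos : 0 < ∫ x, φ x ∂ϖ := by
    rw [integral_pos_iff_support_of_nonneg hφ0 hint]
    exact hφ.isOpen_support.measure_pos ϖ ⟨x₀, by simp [φ]⟩
  refine ⟨fun x => (∫ x, φ x ∂ϖ)⁻¹ * φ x, by fun_prop,
    fun x => mul_nonneg (inv_nonneg.2 hpos.le) (hφ0 x), ⟨(∫ x, φ x ∂ϖ)⁻¹ * 1, fun x =>
      mul_le_mul_of_nonneg_left (hφ1 x) (inv_nonneg.2 hpos.le)⟩, fun x hx => ?_, ?_⟩
  · by_contra! h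
    refine hx ?_
    have : 1 ≤ dist x x₀ / δ := (one_le_div hδ).2 h
    simp [φ, this]
  · rw [integral_const_mul, inv_mul_cancel₀ hpos.ne']

/-- Point masses are replaced by continuous densities `ψ`. Integrating `z` against them gives an
`E`-valued vector, so the smeared form has nonnegative gap, while continuity of `ρ` controls the
smearing error. -/
theorem satisfiesFiniteGapInequalities_of_gammaGap_le {X ι : Type*} [MetricSpace X]
    [SecondCountableTopology X] [MeasurableSpace X] [BorelSpace X]
    (ϖ : Measure X) [IsFiniteMeasure ϖ] [ϖ.IsOpenPosMeasure] {E : Set ℝ}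
    (hcone : ∀ t z : ℝ, 0 ≤ t → z ∈ E → t * z ∈ E)
    (hEint : ∀ f : X → ℝ, (∀ x, f x ∈ E) → ∫ x, f x ∂ϖ ∈ E)
    {ρ : X × X → ℝ} (hρ : Continuous ρ) (hsymm : ∀ x y, ρ (x, y) = ρ (y, x))
    (hgap : ∀ lam : X × X → ℝ, Continuous lam → (∀ x y : X, lam (x, y) = lam (y, x)) →
      MemLp lam 2 (ϖ.prod ϖ) → ExtIntegralExists (fun p => lam p * ρ p) (ϖ.prod ϖ) →
      gammaGap lam E (ϖ.prod ϖ) ≤ extIntegral (fun p => lam p * ρ p) (ϖ.prod ϖ)) (d : ι → X) :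
    SatisfiesFiniteGapInequalities E fun p : ι × ι => ρ (d p.1, d p.2) := by
  classical
  intro F c hc
  suffices h : ∀ ε > 0, -(ε * ∑ p ∈ F, |c p|) ≤ ∑ p ∈ F, c p * ρ (d p.1, d p.2) by
    have hlim : Tendsto (fun ε : ℝ => -(ε * ∑ p ∈ F, |c p|)) (𝓝[>] 0)
        (𝓝 (-(0 * ∑ p ∈ F, |c p|))) :=
      ((continuous_id.mul continuous_const).neg.tendsto (0 : ℝ)).mono_left nhdsWithin_le_nhds
    rw [zero_mul, neg_zero] at hlim
    exact le_of_tendsto hlim (eventually_mem_nhdsWithin.mono fun ε hε => h ε hε)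
  intro ε hε
  obtain ⟨δ, hδ, hδρ⟩ : ∃ δ > 0, ∀ p ∈ F, ∀ x y, dist x (d p.1) < δ → dist y (d p.2) < δ →
      |ρ (x, y) - ρ (d p.1, d p.2)| ≤ ε := by
    have hev : ∀ p ∈ F, ∀ᶠ δ in 𝓝[>] (0 : ℝ), ∀ x y, dist x (d p.1) < δ → dist y (d p.2) < δ →
        |ρ (x, y) - ρ (d p.1, d p.2)| ≤ ε := fun p _ => by
      obtain ⟨η, hη, h⟩ := Metric.continuousAt_iff.1 (hρ.continuousAt (x := (d p.1, d p.2))) ε hε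
      filter_upwards [Ioo_mem_nhdsGT hη] with δ hδ x y hx hy
      exact (h (max_lt (hx.trans hδ.2) (hy.trans hδ.2))).le
    obtain ⟨δ, h, hδ⟩ := (((Filter.eventually_all_finset F).2 hev).and
      eventually_mem_nhdsWithin).exists
    exact ⟨δ, hδ, h⟩
  choose ψ hψc hψ0 hψb hψd hψ1 using fun i => exists_continuous_density ϖ (d i) hδ
  choose C hC using hψb
  have hκc : ∀ i j, Continuous fun p : X × X => ψ i p.1 * ψ j p.2 := fun i j =>
    ((hψc i).comp continuous_fst).mul ((hψc j).comp continuous_snd)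
  have hκb : ∀ i j (p : X × X), |ψ i p.1 * ψ j p.2| ≤ C i * C j := fun i j p => by
    rw [abs_of_nonneg (mul_nonneg (hψ0 i _) (hψ0 j _))]
    exact mul_le_mul (hC i _) (hC j _) (hψ0 j _) ((hψ0 i p.1).trans (hC i _))
  have hκm : ∀ i j, MemLp (fun p : X × X => ψ i p.1 * ψ j p.2) 2 (ϖ.prod ϖ) := fun i j =>
    MemLp.of_bound (hκc i j).aestronglyMeasurable (C i * C j) (Eventually.of_forall (hκb i j))
  have hκ1 : ∀ i j, ∫ p, ψ i p.1 * ψ j p.2 ∂(ϖ.prod ϖ) = 1 := fun i j => by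
    rw [integral_prod_mul, hψ1, hψ1, one_mul]
  -- Symmetrized since `c` need not be symmetric; this doubles both sides of the final estimate.
  let lam : X × X → ℝ := fun q =>
    ∑ p ∈ F, c p * (ψ p.1 q.1 * ψ p.2 q.2 + ψ p.2 q.1 * ψ p.1 q.2)
  have hlam_mul : ∀ (f : X × X → ℝ) (q : X × X), lam q * f q = ∑ p ∈ F,
      c p * (ψ p.1 q.1 * ψ p.2 q.2 * f q + ψ p.2 q.1 * ψ p.1 q.2 * f q) := fun f q => by
    simp only [lam, Finset.sum_mul]
    exact Finset.sum_congr rfl fun p _ => by ring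
  have hint_terms : ∀ f : X × X → ℝ,
      (∀ p ∈ F, Integrable (fun q => ψ p.1 q.1 * ψ p.2 q.2 * f q) (ϖ.prod ϖ)) →
      (∀ p ∈ F, Integrable (fun q => ψ p.2 q.1 * ψ p.1 q.2 * f q) (ϖ.prod ϖ)) →
      Integrable (fun q => lam q * f q) (ϖ.prod ϖ) ∧ ∫ q, lam q * f q ∂(ϖ.prod ϖ) =
        ∑ p ∈ F, c p * (∫ q, ψ p.1 q.1 * ψ p.2 q.2 * f q ∂(ϖ.prod ϖ) +
          ∫ q, ψ p.2 q.1 * ψ p.1 q.2 * f q ∂(ϖ.prod ϖ)) := fun f h1 h2 => by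
    simp only [hlam_mul]
    refine ⟨integrable_finsetSum _ fun p hp => ((h1 p hp).add (h2 p hp)).const_mul _, ?_⟩
    rw [integral_finsetSum F (f := fun p q =>
      c p * (ψ p.1 q.1 * ψ p.2 q.2 * f q + ψ p.2 q.1 * ψ p.1 q.2 * f q))
      fun p hp => ((h1 p hp).add (h2 p hp)).const_mul _]
    refine Finset.sum_congr rfl fun p hp => ?_
    rw [integral_const_mul, integral_add (h1 p hp) (h2 p hp)]
  have happrox : ∀ i j r, (∀ x y, dist x (d i) < δ → dist y (d j) < δ → |ρ (x, y) - r| ≤ ε) →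
      Integrable (fun q => ψ i q.1 * ψ j q.2 * ρ q) (ϖ.prod ϖ) ∧
        |∫ q, ψ i q.1 * ψ j q.2 * ρ q ∂(ϖ.prod ϖ) - r| ≤ ε := fun i j r hr => by
    have hbd : ∀ q : X × X, ‖ψ i q.1 * ψ j q.2 * (ρ q - r)‖ ≤ ψ i q.1 * ψ j q.2 * ε := fun q => by
      rw [norm_mul, Real.norm_of_nonneg (mul_nonneg (hψ0 i _) (hψ0 j _))]
      rcases eq_or_ne (ψ i q.1) 0 with h | h
      · simp [h]
      rcases eq_or_ne (ψ j q.2) 0 with h' | h'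
      · simp [h']
      exact mul_le_mul_of_nonneg_left (hr q.1 q.2 (hψd i _ h) (hψd j _ h'))
        (mul_nonneg (hψ0 i _) (hψ0 j _))
    have hκi := (hκm i j).integrable one_le_two
    have hdiff : Integrable (fun q : X × X => ψ i q.1 * ψ j q.2 * (ρ q - r)) (ϖ.prod ϖ) :=
      (hκi.mul_const ε).mono' ((hκc i j).mul (hρ.sub continuous_const)).aestronglyMeasurable
        (Eventually.of_forall hbd)
    have hsplit : ∀ q : X × X, ψ i q.1 * ψ j q.2 * ρ q
        = ψ i q.1 * ψ j q.2 * (ρ q - r) + ψ i q.1 * ψ j q.2 * r := fun q => by ring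
    simp only [hsplit]
    refine ⟨hdiff.add (hκi.mul_const r), ?_⟩
    rw [integral_add hdiff (hκi.mul_const r), integral_mul_const, hκ1, one_mul,
      add_sub_cancel_right]
    have := norm_integral_le_of_norm_le (hκi.mul_const ε) (Eventually.of_forall hbd)
    rwa [integral_mul_const, hκ1, one_mul] at this
  have h12 := fun p (hp : p ∈ F) => happrox p.1 p.2 _ (hδρ p hp)
  have h21 := fun p (hp : p ∈ F) => happrox p.2 p.1 (ρ (d p.1, d p.2)) fun x y hx hy => by
    rw [hsymm]
    exact hδρ p hp y x hy hx
  obtain ⟨hint, hintegral⟩ := hint_terms ρ (fun p hp => (h12 p hp).1) fun p hp => (h21 p hp).1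
  have hnonneg : (0 : EReal) ≤ gammaGap lam E (ϖ.prod ϖ) := by
    refine le_iInf₂ fun z hz => ?_
    have hz2 := fun i j => (hκm i j).integrable_mul hz.2
    obtain ⟨-, heq⟩ := hint_terms (fun q => z q.1 * z q.2) (fun p _ => hz2 _ _) fun p _ => hz2 _ _
    -- `z` itself may be non-measurable: the product formula holds unconditionally, and a divergent
    -- integral defaults to 0, which `hEint` also covers.
    have hprod : ∀ i j, ∫ q : X × X, ψ i q.1 * ψ j q.2 * (z q.1 * z q.2) ∂(ϖ.prod ϖ)
        = (∫ x, ψ i x * z x ∂ϖ) * ∫ x, ψ j x * z x ∂ϖ := fun i j => by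
      rw [← integral_prod_mul]
      exact integral_congr_ae (Eventually.of_forall fun q => by ring)
    have hw := hc (fun i => ∫ x, ψ i x * z x ∂ϖ) fun i =>
      hEint _ fun x => hcone _ _ (hψ0 i x) (hz.1 x)
    rw [heq, EReal.coe_nonneg]
    simp only [hprod]
    refine (add_nonneg hw hw).trans_eq ?_
    rw [← Finset.sum_add_distrib]
    exact Finset.sum_congr rfl fun p _ => by ring
  have hlamc : Continuous lam := continuous_finsetSum _ fun p _ =>
    continuous_const.mul ((hκc _ _).add (hκc _ _))
  have hlam2 : MemLp lam 2 (ϖ.prod ϖ) :=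
    memLp_finsetSum _ fun p _ => ((hκm _ _).add (hκm _ _)).const_mul _
  have hfinal := hnonneg.trans (hgap lam hlamc (fun x y => Finset.sum_congr rfl fun p _ => by ring)
    hlam2 (extIntegralExists_of_integrable hint))
  rw [extIntegral_eq_integral hint, EReal.coe_nonneg, hintegral] at hfinal
  have hsum : ∑ p ∈ F, c p * (∫ q, ψ p.1 q.1 * ψ p.2 q.2 * ρ q ∂(ϖ.prod ϖ) +
      ∫ q, ψ p.2 q.1 * ψ p.1 q.2 * ρ q ∂(ϖ.prod ϖ))
      ≤ ∑ p ∈ F, (2 * (c p * ρ (d p.1, d p.2)) + 2 * (ε * |c p|)) := by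
    refine Finset.sum_le_sum fun p hp => ?_
    set I := ∫ q, ψ p.1 q.1 * ψ p.2 q.2 * ρ q ∂(ϖ.prod ϖ)
    set J := ∫ q, ψ p.2 q.1 * ψ p.1 q.2 * ρ q ∂(ϖ.prod ϖ)
    have hIJ : |I + J - 2 * ρ (d p.1, d p.2)| ≤ 2 * ε := by
      have := abs_add_le (I - ρ (d p.1, d p.2)) (J - ρ (d p.1, d p.2))
      have := (h12 p hp).2
      have := (h21 p hp).2
      calc _ = |I - ρ (d p.1, d p.2) + (J - ρ (d p.1, d p.2))| := by congr 1; ring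
        _ ≤ _ := by linarith
    have h1 := le_abs_self (c p * (I + J - 2 * ρ (d p.1, d p.2)))
    rw [abs_mul] at h1
    have h2 := mul_le_mul_of_nonneg_left hIJ (abs_nonneg (c p))
    linarith
  rw [Finset.sum_add_distrib, ← Finset.mul_sum, ← Finset.mul_sum, ← Finset.mul_sum] at hsum
  linarith

/-! ### Covariances satisfy the gap inequalities -/

section RandomField

variable {X : Type*} {E : Set ℝ} {ρ : X × X → ℝ} {P : Measure (X → E)}

/-- From `|uv| ≤ (u² + v²) / 2`; it provides the dominating function for `λρ` where the diagonal is
bounded. -/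
theorem abs_covariance_le (hZ : ∀ x : X, MemLp (fun ω : X → E => (ω x : ℝ)) 2 P)
    (hρP : ∀ x y : X, ρ (x, y) = ∫ ω : X → E, (ω x : ℝ) * (ω y : ℝ) ∂P) {x y : X} {M : ℝ}
    (hx : ρ (x, x) ≤ M) (hy : ρ (y, y) ≤ M) : |ρ (x, y)| ≤ M := by
  have hint : ∀ x y, Integrable (fun ω : X → E => (ω x : ℝ) * (ω y : ℝ)) P := fun x y =>
    (hZ x).integrable_mul (hZ y)
  have hbound := norm_integral_le_of_norm_le (((hint x x).add (hint y y)).div_const 2)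
    (f := fun ω : X → E => (ω x : ℝ) * (ω y : ℝ)) (Eventually.of_forall fun ω => by
      simp only [Pi.add_apply, Real.norm_eq_abs]
      exact abs_le.2 ⟨by nlinarith [sq_nonneg ((ω x : ℝ) + ω y)],
        by nlinarith [sq_nonneg ((ω x : ℝ) - ω y)]⟩)
  rw [integral_div, integral_add' (hint x x) (hint y y), ← hρP, ← hρP, ← hρP] at hbound
  rw [← Real.norm_eq_abs]
  linarith

/-- The gap inequality for a finitely valued discretization of a random field. -/
theorem le_integral_mul_comp_simpleFunc [MeasurableSpace X] [IsProbabilityMeasure P]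
    (hZ : ∀ x : X, MemLp (fun ω : X → E => (ω x : ℝ)) 2 P)
    (hρP : ∀ x y : X, ρ (x, y) = ∫ ω : X → E, (ω x : ℝ) * (ω y : ℝ) ∂P)
    {ν : Measure (X × X)} {lam : X × X → ℝ} (hlam : Integrable lam ν) (f : SimpleFunc X X) {g : ℝ}
    (hg : ∀ ω : X → E, g ≤ ∫ p, lam p * ((ω (f p.1) : ℝ) * ω (f p.2)) ∂ν) :
    g ≤ ∫ p, lam p * ρ (f p.1, f p.2) ∂ν := by
  classical
  let D : X × X → Set (X × X) := fun e => (f ⁻¹' {e.1}) ×ˢ (f ⁻¹' {e.2})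
  have hD : ∀ e, MeasurableSet (D e) := fun e =>
    (f.measurableSet_preimage _).prod (f.measurableSet_preimage _)
  have hsum : ∀ G : X × X → ℝ, ∫ p, lam p * G (f p.1, f p.2) ∂ν
      = ∑ e ∈ f.range ×ˢ f.range, (∫ p in D e, lam p ∂ν) * G e := fun G => by
    have hpt : ∀ p : X × X, lam p * G (f p.1, f p.2)
        = ∑ e ∈ f.range ×ˢ f.range, (D e).indicator lam p * G e := fun p => by
      rw [Finset.sum_eq_single (f p.1, f p.2)]
      · simp [D]
      · intro e _ he
        have : p ∉ D e := fun hp => he (Prod.ext hp.1.symm hp.2.symm)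
        simp [this]
      · intro h
        exact absurd (Finset.mem_product.2 ⟨f.mem_range_self _, f.mem_range_self _⟩) h
    simp only [hpt]
    rw [integral_finsetSum _ fun e _ => (hlam.indicator (hD e)).mul_const _]
    refine Finset.sum_congr rfl fun e _ => ?_
    rw [integral_mul_const, integral_indicator (hD e)]
  rw [hsum]
  have hint : ∀ e : X × X, Integrable
      (fun ω : X → E => (∫ p in D e, lam p ∂ν) * ((ω e.1 : ℝ) * ω e.2)) P := fun e =>
    ((hZ e.1).integrable_mul (hZ e.2)).const_mul _
  calc g = ∫ _ : X → E, g ∂P := by simp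
    _ ≤ ∫ ω : X → E, ∑ e ∈ f.range ×ˢ f.range,
          (∫ p in D e, lam p ∂ν) * ((ω e.1 : ℝ) * ω e.2) ∂P := by
        refine integral_mono (integrable_const _) (integrable_finsetSum _ fun e _ => hint e)
          fun ω => ?_
        exact (hg ω).trans_eq (hsum fun e => (ω e.1 : ℝ) * ω e.2)
    _ = _ := by
        rw [integral_finsetSum _ fun e _ => hint e]
        refine Finset.sum_congr rfl fun e _ => ?_
        rw [integral_const_mul, ← hρP]

end RandomField

theorem gammaGap_le_zero {X : Type*} [MeasurableSpace X] {E : Set ℝ} (h0 : (0 : ℝ) ∈ E)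
    (lam : X × X → ℝ) (μ : Measure (X × X)) : gammaGap lam E μ ≤ 0 :=
  (iInf₂_le (0 : X → ℝ) ⟨fun _ => h0, by simp⟩).trans_eq (by simp)

theorem gammaGap_le_setIntegral {X : Type*} [MetricSpace X] [SecondCountableTopology X]
    [MeasurableSpace X] [BorelSpace X] (ϖ : Measure X) [IsFiniteMeasure ϖ] {E : Set ℝ}
    (h0 : (0 : ℝ) ∈ E) {ρ : X × X → ℝ} (hρ : Continuous ρ)
    {P : Measure (X → E)} [IsProbabilityMeasure P]
    (hZ : ∀ x : X, MemLp (fun ω : X → E => (ω x : ℝ)) 2 P)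
    (hρP : ∀ x y : X, ρ (x, y) = ∫ ω : X → E, (ω x : ℝ) * (ω y : ℝ) ∂P)
    {lam : X × X → ℝ} (hlam : Integrable lam (ϖ.prod ϖ)) {A : Set X} (hA : MeasurableSet A) {M : ℝ}
    (hM : ∀ x ∈ A, ρ (x, x) ≤ M) :
    gammaGap lam E (ϖ.prod ϖ) ≤ ((∫ p in A ×ˢ A, lam p * ρ p ∂(ϖ.prod ϖ) : ℝ) : EReal) := by
  classical
  rcases A.eq_empty_or_nonempty with rfl | ⟨y₀, hy₀⟩
  · simpa using gammaGap_le_zero h0 lam (ϖ.prod ϖ)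
  rcases eq_or_ne (gammaGap lam E (ϖ.prod ϖ)) ⊥ with hbot | hbot
  · rw [hbot]; exact bot_le
  have htop : gammaGap lam E (ϖ.prod ϖ) ≠ ⊤ := fun h => by
    have := gammaGap_le_zero h0 lam (ϖ.prod ϖ)
    rw [h] at this
    simp at this
  lift gammaGap lam E (ϖ.prod ϖ) to ℝ using ⟨htop, hbot⟩ with g hg
  rw [EReal.coe_le_coe_iff]
  let f : ℕ → SimpleFunc X X := SimpleFunc.approxOn id measurable_id A y₀ hy₀
  have hfA : ∀ n x, f n x ∈ A := fun n x => SimpleFunc.approxOn_mem measurable_id hy₀ n x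
  have hflim : ∀ x ∈ A, Tendsto (fun n => f n x) atTop (𝓝 x) := fun x hx =>
    SimpleFunc.tendsto_approxOn measurable_id hy₀ (subset_closure hx)
  have hle : ∀ n, g ≤ ∫ p in A ×ˢ A, lam p * ρ (f n p.1, f n p.2) ∂(ϖ.prod ϖ) := fun n => by
    refine le_integral_mul_comp_simpleFunc hZ hρP hlam.integrableOn (f n) fun ω => ?_
    -- The discretized path, set to `0 ∈ E` off `A`, is bounded and measurable, hence a competitor.
    let h : SimpleFunc X ℝ := ((f n).map fun x => (ω x : ℝ)).restrict A
    have hh : ∀ x, h x = A.indicator (fun x => (ω (f n x) : ℝ)) x := fun x => by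
      simp [h, SimpleFunc.restrict_apply _ hA, Set.indicator]
    have hE : ∀ x, h x ∈ E := fun x => by
      rw [hh, Set.indicator_apply]
      split_ifs
      exacts [(ω (f n x)).2, h0]
    have hLp : MemLp (fun p : X × X => h p.1 * h p.2) 2 (ϖ.prod ϖ) := by
      obtain ⟨C, hC⟩ := h.exists_forall_norm_le
      refine MemLp.of_bound ((h.measurable.comp measurable_fst).mul
        (h.measurable.comp measurable_snd)).aestronglyMeasurable (C * C)
        (Eventually.of_forall fun p => ?_)
      rw [norm_mul]
      exact mul_le_mul (hC _) (hC _) (norm_nonneg _) ((norm_nonneg _).trans (hC p.1))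
    have hgap : (g : EReal) ≤ ((∫ p, lam p * (h p.1 * h p.2) ∂(ϖ.prod ϖ) : ℝ) : EReal) :=
      hg.trans_le (iInf₂_le (h : X → ℝ) ⟨hE, hLp⟩)
    rw [EReal.coe_le_coe_iff] at hgap
    refine hgap.trans_eq ?_
    rw [← integral_indicator (hA.prod hA)]
    refine integral_congr_ae (Eventually.of_forall fun p => ?_)
    by_cases h1 : p.1 ∈ A <;> by_cases h2 : p.2 ∈ A <;> simp [hh, h1, h2]
  refine ge_of_tendsto' (tendsto_integral_of_dominated_convergence (fun p => ‖lam p‖ * M)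
    (fun n => ?_) (hlam.norm.mul_const M).integrableOn (fun n => ?_) ?_) hle
  · exact hlam.integrableOn.aestronglyMeasurable.mul (hρ.measurable.comp
      (((f n).measurable.comp measurable_fst).prodMk
        ((f n).measurable.comp measurable_snd))).aestronglyMeasurable
  · refine Eventually.of_forall fun p => ?_
    rw [norm_mul]
    exact mul_le_mul_of_nonneg_left
      (abs_covariance_le hZ hρP (hM _ (hfA n _)) (hM _ (hfA n _))) (norm_nonneg _)
  · refine (ae_restrict_iff' (hA.prod hA)).2 (Eventually.of_forall fun p hp => ?_)
    exact ((hρ.tendsto p).comp ((hflim _ hp.1).prodMk_nhds (hflim _ hp.2))).const_mul _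

theorem tendsto_setLIntegral_of_monotone {Y : Type*} [MeasurableSpace Y] {μ : Measure Y}
    {S : ℕ → Set Y} (hmono : Monotone S) (hunion : ⋃ n, S n = Set.univ)
    (F : Y → ENNReal) :
    Tendsto (fun n => ∫⁻ y in S n, F y ∂μ) atTop (𝓝 (∫⁻ y, F y ∂μ)) := by
  rw [← setLIntegral_univ, ← hunion, setLIntegral_iUnion_of_directed F hmono.directed_le]
  exact tendsto_atTop_iSup fun m n hmn => lintegral_mono_set (hmono hmn)

/-- Addition in `EReal` is discontinuous only where infinities of opposite sign meet, which
existence of the integral excludes. -/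
theorem tendsto_extIntegral_restrict {Y : Type*} [MeasurableSpace Y] {μ : Measure Y}
    {S : ℕ → Set Y} (hmono : Monotone S) (hunion : ⋃ n, S n = Set.univ)
    {f : Y → ℝ} (hf : ExtIntegralExists f μ) :
    Tendsto (fun n => extIntegral f (μ.restrict (S n))) atTop (𝓝 (extIntegral f μ)) := by
  have hpos := (continuous_coe_ennreal_ereal.tendsto _).comp
    (tendsto_setLIntegral_of_monotone (μ := μ) hmono hunion fun y => ENNReal.ofReal (f y))
  have hneg := (continuous_neg.tendsto _).comp ((continuous_coe_ennreal_ereal.tendsto _).comp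
    (tendsto_setLIntegral_of_monotone (μ := μ) hmono hunion fun y => ENNReal.ofReal (-f y)))
  have hadd : ContinuousAt (fun p : EReal × EReal => p.1 + p.2)
      (((∫⁻ y, ENNReal.ofReal (f y) ∂μ : ENNReal) : EReal),
        -((∫⁻ y, ENNReal.ofReal (-f y) ∂μ : ENNReal) : EReal)) := by
    refine EReal.continuousAt_add ?_ (Or.inl (EReal.coe_ennreal_ne_bot _))
    rcases hf with h | h
    · exact Or.inl (by simpa using h)
    · exact Or.inr (by simpa using h)
  exact hadd.tendsto.comp (hpos.prodMk_nhds hneg)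

theorem IsNonCenteredCovariance.gammaGap_le_extIntegral {X : Type*} [MetricSpace X]
    [SecondCountableTopology X] [MeasurableSpace X] [BorelSpace X] (ϖ : Measure X)
    [IsFiniteMeasure ϖ] {E : Set ℝ} (h0 : (0 : ℝ) ∈ E) {ρ : X × X → ℝ} (hρ : Continuous ρ)
    (hcov : IsNonCenteredCovariance E ρ) {lam : X × X → ℝ} (hlam : Integrable lam (ϖ.prod ϖ))
    (hex : ExtIntegralExists (fun p => lam p * ρ p) (ϖ.prod ϖ)) :
    gammaGap lam E (ϖ.prod ϖ) ≤ extIntegral (fun p => lam p * ρ p) (ϖ.prod ϖ) := by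
  obtain ⟨P, hP, hZ, hρP⟩ := hcov
  let A : ℕ → Set X := fun n => {x | ρ (x, x) ≤ n}
  have hA : ∀ n, MeasurableSet (A n) := fun n =>
    (isClosed_le (hρ.comp (continuous_id.prodMk continuous_id)) continuous_const).measurableSet
  have hmono : Monotone fun n => A n ×ˢ A n := fun m n hmn => by
    have : A m ⊆ A n := fun x (hx : ρ (x, x) ≤ m) => hx.trans (Nat.cast_le.2 hmn)
    exact Set.prod_mono this this
  have hunion : ⋃ n, A n ×ˢ A n = Set.univ := Set.eq_univ_of_forall fun p => by
    obtain ⟨n, hn⟩ := exists_nat_ge (max (ρ (p.1, p.1)) (ρ (p.2, p.2)))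
    exact Set.mem_iUnion.2 ⟨n, (le_max_left _ _).trans hn, (le_max_right _ _).trans hn⟩
  refine ge_of_tendsto' (tendsto_extIntegral_restrict hmono hunion hex) fun n => ?_
  have hint : Integrable (fun p => lam p * ρ p) ((ϖ.prod ϖ).restrict (A n ×ˢ A n)) := by
    refine (hlam.norm.mul_const (n : ℝ)).integrableOn.mono'
      (hlam.integrableOn.aestronglyMeasurable.mul hρ.aestronglyMeasurable)
      ((ae_restrict_iff' ((hA n).prod (hA n))).2 (Eventually.of_forall fun p hp => ?_))
    rw [norm_mul]
    exact mul_le_mul_of_nonneg_left (abs_covariance_le hZ hρP hp.1 hp.2) (norm_nonneg _)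
  rw [extIntegral_eq_integral hint]
  exact gammaGap_le_setIntegral ϖ h0 hρ hZ hρP hlam (hA n) fun x hx => hx

/-! ### The characterization -/

theorem theorem12 {X : Type*} [MetricSpace X] [MeasurableSpace X] [BorelSpace X]
    (ϖ : Measure X) [IsFiniteMeasure ϖ] [ϖ.IsOpenPosMeasure]
    (E : Set ℝ) (hE : E = Set.univ ∨ E = Set.Ici 0 ∨ E = Set.Iic 0)
    (ρ : X × X → ℝ) (hρ : Continuous ρ) :
    IsNonCenteredCovariance E ρ ↔
      (∀ x y : X, ρ (x, y) = ρ (y, x)) ∧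
      ∀ lam : X × X → ℝ, Continuous lam → (∀ x y : X, lam (x, y) = lam (y, x)) →
        MemLp lam 2 (ϖ.prod ϖ) →
        ExtIntegralExists (fun p => lam p * ρ p) (ϖ.prod ϖ) →
        gammaGap lam E (ϖ.prod ϖ) ≤ extIntegral (fun p => lam p * ρ p) (ϖ.prod ϖ) := by
  have hsc := secondCountableTopology_of_isOpenPosMeasure ϖ
  have hclosed : IsClosed E := by
    rcases hE with rfl | rfl | rfl
    exacts [isClosed_univ, isClosed_Ici, isClosed_Iic]
  have h0 : (0 : ℝ) ∈ E := by
    rcases hE with rfl | rfl | rfl <;> simp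
  have hcone : ∀ t z : ℝ, 0 ≤ t → z ∈ E → t * z ∈ E := by
    rcases hE with rfl | rfl | rfl
    · exact fun _ _ _ _ => trivial
    · exact fun _ _ => mul_nonneg
    · exact fun _ _ => mul_nonpos_of_nonneg_of_nonpos
  have hEint : ∀ f : X → ℝ, (∀ x, f x ∈ E) → ∫ x, f x ∂ϖ ∈ E := by
    rcases hE with rfl | rfl | rfl
    · exact fun _ _ => trivial
    · exact fun f hf => Set.mem_Ici.2 (integral_nonneg hf)
    · exact fun f hf => Set.mem_Iic.2 (integral_nonpos hf)
  constructor
  · intro hcov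
    refine ⟨fun x y => ?_, fun lam _ _ hlam hex =>
      hcov.gammaGap_le_extIntegral ϖ h0 hρ (hlam.integrable one_le_two) hex⟩
    obtain ⟨P, -, -, hρP⟩ := hcov
    rw [hρP, hρP]
    exact integral_congr_ae (Eventually.of_forall fun ω => mul_comm _ _)
  · rintro ⟨hsymm, hgap⟩
    -- A dense sequence needs a point; over the empty space the only path carries a Dirac mass.
    rcases isEmpty_or_nonempty X with hX | hX
    · exact ⟨Measure.dirac isEmptyElim, inferInstance, isEmptyElim, isEmptyElim⟩
    have hfin := satisfiesFiniteGapInequalities_of_gammaGap_le ϖ hcone hEint hρ hsymm hgap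
      (TopologicalSpace.denseSeq X)
    obtain ⟨Ω, _, P, Z, hP, hZ, hZE, hZρ⟩ := hfin.exists_randomVariables hclosed h0 hcone
    exact IsNonCenteredCovariance.of_denseRange hclosed h0 hρ
      (TopologicalSpace.denseRange_denseSeq X) hZ hZE hZρ
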